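/- Let $G=(V,E)$ be a connected, locally finite (simple) graph, let $\Gamma$ be a subgroup of $\mathrm{Aut}(G)$ that is closed in the topology of pointwise convergence and acts transitively on $V$. For $x,y\in V$ put $$\mathbf w_\Gamma^{y}(x):=\frac{|\Gamma_x y|}{|\Gamma_y x|},\qquad \Gamma_v:=\{\gamma\in\Gamma:\gamma v=v\},$$ and $\mathbf w_\Gamma^{o}(A):=\sum_{x\in A}\mathbf w_\Gamma^{o}(x)$ for finite $A\subseteq V$; the level of $x$ is $\{y\in V:\mathbf w_\Gamma^{x}(y)=1\}$. Write $\partial_V F$ for the external vertex boundary of $F\subseteq V$. Suppose that $G$ is $\mathbf w$-nonamenable, i.e. for some (equivalently, any) reference vertex $o\in V$, $$\inf_{\emptyset\ne F\subseteq V,\ |F|<\infty}\frac{\mathbf w_\Gamma^{o}(\partial_V F)}{\mathbf w_\Gamma^{o}(F)}>0 .$$ Then there is a connected, locally finite, vertex-transitive graph $G'$ on the same vertex set $V$ such that 1. $G'$ is quasi-isometric to $G$ (with respect to the graph distances); 2. $\Gamma$, as a group of permutations of $V$, is a closed subgroup of $\mathrm{Aut}(G')$, and it induces the same relative weight function $\mathbf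 w_\Gamma$; 3. every level $L$ induces a nonamenable subgraph $G'[L]$ of $G'$, i.e. its Cheeger constant $\inf\{|\partial_V K|/|K| : \emptyset\ne K\subseteq L,\ |K|<\infty\}$, with $\partial_V K$ taken in $G'[L]$, is positive. -/

import Mathlib

namespace WeightedGraph

variable {V : Type*}

/-- Every vertex has finitely many neighbours. -/
def IsLocallyFinite (G : SimpleGraph V) : Prop :=
  ∀ v : V, (G.neighborSet v).Finite

/-- The topology of pointwise convergence on `Aut(G)`, the vertex set being discrete. -/
abbrev autTopology (G : SimpleGraph V) : TopologicalSpace (G ≃g G) :=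
  TopologicalSpace.induced (fun (γ : G ≃g G) (v : V) => γ v)
    (@Pi.topologicalSpace V (fun _ => V) (fun _ => ⊥))

/-- `Γ` is a closed subgroup of `Aut(G)`. -/
def IsClosedSubgroup {G : SimpleGraph V} (Γ : Subgroup (G ≃g G)) : Prop :=
  @IsClosed (G ≃g G) (autTopology G) (Γ : Set (G ≃g G))

/-- `G` is (vertex-)transitive: `Aut(G)` acts transitively on the vertices. -/
def IsTransitiveGraph (G : SimpleGraph V) : Prop :=
  MulAction.IsPretransitive (G ≃g G) V

/-- The relative weight function of `Γ`: `relWeight Γ o x` is the weight of `x` with respect to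
the reference vertex `o`, that is `|Γ_x o| / |Γ_o x|`, with `Γ_v` the stabilizer of `v` in `Γ`. -/
noncomputable def relWeight {G : SimpleGraph V} (Γ : Subgroup (G ≃g G)) (o x : V) : ℝ :=
  ((MulAction.orbit (MulAction.stabilizer Γ x) o).ncard : ℝ) /
    ((MulAction.orbit (MulAction.stabilizer Γ o) x).ncard : ℝ)

/-- The level of `x`: all vertices of weight `1` with respect to `x`. -/
def level {G : SimpleGraph V} (Γ : Subgroup (G ≃g G)) (x : V) : Set V :=
  {y | relWeight Γ x y = 1}

/-- The weight of a set of vertices with respect to `o` (used only for finite sets). -/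
noncomputable def setWeight {G : SimpleGraph V} (Γ : Subgroup (G ≃g G)) (o : V) (A : Set V) : ℝ :=
  ∑ᶠ x ∈ A, relWeight Γ o x

/-- The external vertex boundary of `F`. -/
def vertexBoundary (G : SimpleGraph V) (F : Set V) : Set V :=
  {y | y ∉ F ∧ ∃ x ∈ F, G.Adj x y}

/-- The Cheeger constant: the infimum of `|∂F| / |F|` over nonempty finite `F`. -/
noncomputable def cheegerConst (G : SimpleGraph V) : ℝ :=
  sInf {r : ℝ | ∃ F : Set V, F.Finite ∧ F.Nonempty ∧
    r = ((vertexBoundary G F).ncard : ℝ) / (F.ncard : ℝ)}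

/-- Graph-amenability of a locally finite graph. -/
def IsAmenable (G : SimpleGraph V) : Prop :=
  cheegerConst G = 0

/-- The weighted Cheeger constant with reference vertex `o`: the infimum of `w(∂F) / w(F)` over
nonempty finite `F`. -/
noncomputable def weightedCheegerConst {G : SimpleGraph V} (Γ : Subgroup (G ≃g G)) (o : V) : ℝ :=
  sInf {r : ℝ | ∃ F : Set V, F.Finite ∧ F.Nonempty ∧
    r = setWeight Γ o (vertexBoundary G F) / setWeight Γ o F}

/-- Weighted-amenability of `G` with respect to the action of `Γ`, with reference vertex `o`. -/
def IsWeightedAmenable {G : SimpleGraph V} (Γ : Subgroup (G ≃g G)) (o : V) : Prop :=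
  weightedCheegerConst Γ o = 0

/-- Two connected graphs are quasi-isometric with respect to their graph distances. -/
def IsQuasiIsometric {W : Type*} (G : SimpleGraph V) (H : SimpleGraph W) : Prop :=
  ∃ (f : V → W) (A B : ℝ), 1 ≤ A ∧ 0 ≤ B ∧
    (∀ x y : V, A⁻¹ * (G.dist x y : ℝ) - B ≤ (H.dist (f x) (f y) : ℝ) ∧
      (H.dist (f x) (f y) : ℝ) ≤ A * (G.dist x y : ℝ) + B) ∧
    (∀ z : W, ∃ x : V, (H.dist z (f x) : ℝ) ≤ B)

/-- `Γ ≤ Aut(G)` and `Γ' ≤ Aut(G')` are the same group of permutations of the vertex set. -/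
def SamePermutations {G G' : SimpleGraph V} (Γ : Subgroup (G ≃g G))
    (Γ' : Subgroup (G' ≃g G')) : Prop :=
  {σ : Equiv.Perm V | ∃ γ ∈ Γ, γ.toEquiv = σ} = {σ : Equiv.Perm V | ∃ γ ∈ Γ', γ.toEquiv = σ}

end WeightedGraph

/-! The graph $G'$ is a power of $G$: distinct vertices at distance at most $k = 2r+1$ become
adjacent. Quasi-isometry, closedness and equality of weights are then formal; the content is the
choice of $k$, in `exists_powerGraph_level_nonamenable`.

The weights form a commutative monoid under multiplication, and those of the neighbours of $o$
generate a submonoid of polynomial growth. Hence there are finite sets of weights $B \subseteq B'$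
with $|B'| \le (1+\varepsilon)|B|$ such that crossing an edge from a weight in $B$ leads into $B'$
(`exists_folner_weights`). Choose $z_b$ of weight $b$ for each $b \in B'$, and let $r$ bound the
distances from $o$ to the $z_b$.

If a level were amenable in $G'$, it would contain a finite $K$ with boundary of size at most
$\varepsilon|K|$. Spread $K$ along the orbitals of $(o, z_b)$, $b \in B$, to get a finite $F$.
Double counting along orbitals gives $F$ weight at least $|B||K|$ and $\partial F$ weight at most
$\varepsilon(2+\varepsilon)|B||K|$ (`exists_setWeight_vertexBoundary_le`). For small $\varepsilon$
this contradicts weighted nonamenability. -/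

namespace WeightedGraph

open MulAction

/-! ### Weights of a group action with finite suborbits -/

section Action

variable {H V : Type*} [Group H] [MulAction H V]

lemma ncard_orbit_stabilizer (x y : V) :
    (orbit (stabilizer H x) y).ncard = (stabilizer H y).relIndex (stabilizer H x) := by
  rw [← index_stabilizer, Subgroup.relIndex]
  congr 1

variable (H) in
/-- The weight of `x` with respect to `o` for the action of `H`. -/
noncomputable def actWeight (o x : V) : ℝ :=
  ((orbit (stabilizer H x) o).ncard : ℝ) / ((orbit (stabilizer H o) x).ncard : ℝ)

variable (H V) in
/-- All orbits of point stabilizers are finite. -/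
def FiniteSuborbits : Prop :=
  ∀ x y : V, (orbit (stabilizer H x) y).Finite

lemma FiniteSuborbits.ncard_pos (h : FiniteSuborbits H V) (x y : V) :
    0 < (orbit (stabilizer H x) y).ncard :=
  (Set.ncard_pos (h x y)).2 (nonempty_orbit y)

lemma FiniteSuborbits.relIndex_ne_zero (h : FiniteSuborbits H V) (x y : V) :
    (stabilizer H y).relIndex (stabilizer H x) ≠ 0 := by
  rw [← ncard_orbit_stabilizer]
  exact (h.ncard_pos x y).ne'

lemma FiniteSuborbits.actWeight_pos (h : FiniteSuborbits H V) (x y : V) :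
    0 < actWeight H x y :=
  div_pos (Nat.cast_pos.2 (h.ncard_pos _ _)) (Nat.cast_pos.2 (h.ncard_pos _ _))

/-- Indices multiply along $N \le A \cap B \le A$ and $N \le A \cap B \le B$, so the common factor
$[A \cap B : N]$ cancels. -/
lemma relIndex_div_relIndex {A B N : Subgroup H} (hA : N ≤ A) (hB : N ≤ B)
    (hN : N.relIndex A ≠ 0) :
    (A.relIndex B : ℝ) / (B.relIndex A : ℝ) = (N.relIndex B : ℝ) / (N.relIndex A : ℝ) := by
  have h1 := Subgroup.relIndex_mul_relIndex N (A ⊓ B) A (le_inf hA hB) inf_le_left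
  have h2 := Subgroup.relIndex_mul_relIndex N (A ⊓ B) B (le_inf hA hB) inf_le_right
  rw [Subgroup.inf_relIndex_right] at h2
  rw [Subgroup.inf_relIndex_left] at h1
  have h3 : N.relIndex (A ⊓ B) ≠ 0 := fun h ↦ hN (by rw [← h1, h, zero_mul])
  rw [← h1, ← h2]
  push_cast
  rw [mul_div_mul_left _ _ (Nat.cast_ne_zero.2 h3)]

/-- The cocycle identity: the three stabilizers are all compared with their intersection, and the
ratios telescope. -/
lemma FiniteSuborbits.actWeight_mul (h : FiniteSuborbits H V) (x y z : V) :
    actWeight H x y * actWeight H y z = actWeight H x z := by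
  set A := stabilizer H x with hA
  set B := stabilizer H y with hB
  set C := stabilizer H z with hC
  have hNA : (A ⊓ (B ⊓ C)).relIndex A ≠ 0 := by
    rw [Subgroup.inf_relIndex_left]
    exact Subgroup.relIndex_inf_ne_zero (h.relIndex_ne_zero x y) (h.relIndex_ne_zero x z)
  have hNB : (A ⊓ (B ⊓ C)).relIndex B ≠ 0 := by
    refine Subgroup.relIndex_inf_ne_zero (h.relIndex_ne_zero y x) ?_
    rw [Subgroup.inf_relIndex_left]
    exact h.relIndex_ne_zero y z
  have lA : A ⊓ (B ⊓ C) ≤ A := inf_le_left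
  have lB : A ⊓ (B ⊓ C) ≤ B := inf_le_right.trans inf_le_left
  have lC : A ⊓ (B ⊓ C) ≤ C := inf_le_right.trans inf_le_right
  simp only [actWeight, ncard_orbit_stabilizer]
  rw [← hA, ← hB, ← hC, relIndex_div_relIndex lA lB hNA, relIndex_div_relIndex lB lC hNB,
    relIndex_div_relIndex lA lC hNA]
  field_simp [(Nat.cast_ne_zero (R := ℝ)).2 hNB]

lemma FiniteSuborbits.actWeight_self (h : FiniteSuborbits H V) (x : V) :
    actWeight H x x = 1 :=
  div_self (Nat.cast_pos.2 (h.ncard_pos _ _)).ne'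

lemma orbit_stabilizer_smul (g : H) (x y : V) :
    orbit (stabilizer H (g • x)) (g • y) = (g • ·) '' orbit (stabilizer H x) y := by
  ext z
  constructor
  · rintro ⟨⟨a, ha⟩, rfl⟩
    refine ⟨(g⁻¹ * a * g) • y, ⟨⟨g⁻¹ * a * g, ?_⟩, rfl⟩, ?_⟩
    · rw [mem_stabilizer_iff] at ha ⊢
      rw [mul_smul, mul_smul, ha, inv_smul_smul]
    · simp [mul_smul, Subgroup.smul_def]
  · rintro ⟨_, ⟨⟨a, ha⟩, rfl⟩, rfl⟩
    refine ⟨⟨g * a * g⁻¹, ?_⟩, ?_⟩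
    · rw [mem_stabilizer_iff] at ha ⊢
      rw [mul_smul, mul_smul, inv_smul_smul, ha]
    · simp [mul_smul, Subgroup.smul_def]

lemma ncard_orbit_stabilizer_smul (g : H) (x y : V) :
    (orbit (stabilizer H (g • x)) (g • y)).ncard = (orbit (stabilizer H x) y).ncard := by
  rw [orbit_stabilizer_smul, Set.ncard_image_of_injective _ (MulAction.injective g)]

lemma actWeight_smul (g : H) (x y : V) : actWeight H (g • x) (g • y) = actWeight H x y := by
  simp only [actWeight, ncard_orbit_stabilizer_smul]

variable (H) in
/-- The orbital relation of the pair `(o, z)`. -/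
def Orbital (o z x y : V) : Prop := ∃ g : H, g • o = x ∧ g • z = y

lemma orbital_swap {o z x y : V} : Orbital H o z x y ↔ Orbital H z o y x := by
  simp only [Orbital, and_comm]

lemma Orbital.actWeight {o z x y : V} (h : Orbital H o z x y) :
    actWeight H x y = actWeight H o z := by
  obtain ⟨g, rfl, rfl⟩ := h
  exact actWeight_smul g o z

lemma setOf_orbital_smul (o z : V) (g : H) :
    {y | Orbital H o z (g • o) y} = (g • ·) '' orbit (stabilizer H o) z := by
  ext y
  constructor
  · rintro ⟨a, ha, rfl⟩
    refine ⟨(g⁻¹ * a) • z, ⟨⟨g⁻¹ * a, ?_⟩, rfl⟩, by simp [mul_smul]⟩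
    rw [mem_stabilizer_iff, mul_smul, ha, inv_smul_smul]
  · rintro ⟨_, ⟨⟨a, ha⟩, rfl⟩, rfl⟩
    exact ⟨g * a, by rw [mul_smul, mem_stabilizer_iff.1 ha], by simp [mul_smul, Subgroup.smul_def]⟩

variable [IsPretransitive H V]

lemma FiniteSuborbits.finite_orbital (h : FiniteSuborbits H V) (o z x : V) :
    {y | Orbital H o z x y}.Finite := by
  obtain ⟨g, rfl⟩ := exists_smul_eq H o x
  rw [setOf_orbital_smul]
  exact (h o z).image _

lemma ncard_orbital (o z x : V) :
    {y | Orbital H o z x y}.ncard = (orbit (stabilizer H o) z).ncard := by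
  obtain ⟨g, rfl⟩ := exists_smul_eq H o x
  rw [setOf_orbital_smul, Set.ncard_image_of_injective _ (MulAction.injective g)]

/-- Double counting along an orbital relation. -/
lemma FiniteSuborbits.card_mul_le_of_orbital (h : FiniteSuborbits H V) (o z : V) {X Y : Finset V}
    (hXY : ∀ x ∈ X, ∀ y, Orbital H o z x y → y ∈ Y) :
    X.card * (orbit (stabilizer H o) z).ncard ≤ Y.card * (orbit (stabilizer H z) o).ncard := by
  classical
  refine Finset.card_mul_le_card_mul (Orbital H o z) (fun x hx ↦ ?_) (fun y _ ↦ ?_)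
  · rw [← ncard_orbital o z x, ← Set.ncard_coe_finset]
    refine Set.ncard_le_ncard (fun y hy ↦ ?_) (Finset.finite_toSet _)
    simpa using ⟨hXY x hx y hy, hy⟩
  · rw [← ncard_orbital z o y, ← Set.ncard_coe_finset]
    refine Set.ncard_le_ncard (fun x hx ↦ ?_) (h.finite_orbital _ _ _)
    exact orbital_swap.1 ((Finset.mem_bipartiteBelow _).1 hx).2

/-- The orbital has out-degree $|\Gamma_o z|$ and in-degree $|\Gamma_z o|$; their ratio is the
weight of $z$. -/
lemma FiniteSuborbits.card_le_card_mul_actWeight (h : FiniteSuborbits H V) (o z : V)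
    {X Y : Finset V} (hXY : ∀ x ∈ X, ∀ y, Orbital H o z x y → y ∈ Y) :
    (X.card : ℝ) ≤ Y.card * WeightedGraph.actWeight H o z := by
  have := h.card_mul_le_of_orbital o z hXY
  rw [WeightedGraph.actWeight, mul_div_assoc', le_div_iff₀ (Nat.cast_pos.2 (h.ncard_pos _ _))]
  exact_mod_cast this

lemma FiniteSuborbits.card_mul_actWeight_le_card (h : FiniteSuborbits H V) (o z : V)
    {X Y : Finset V} (hXY : ∀ y ∈ Y, ∀ x, Orbital H o z x y → x ∈ X) :
    (Y.card : ℝ) * WeightedGraph.actWeight H o z ≤ X.card := by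
  have := h.card_mul_le_of_orbital z o (X := Y) (Y := X)
    (fun y hy x hx ↦ hXY y hy x (orbital_swap.1 hx))
  rw [WeightedGraph.actWeight, mul_div_assoc', div_le_iff₀ (Nat.cast_pos.2 (h.ncard_pos _ _))]
  exact_mod_cast this

end Action

/-! ### Følner sets in commutative monoids -/

/-- The image of the box of side `n` under the product map of a finite set. -/
noncomputable def boxProducts {M : Type*} [CommMonoid M] (S : Finset M) (n : ℕ) : Finset M :=
  open Classical in
  (Fintype.piFinset fun _ : S ↦ Finset.range (n + 1)).image fun e ↦ ∏ s : S, (s : M) ^ e s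

section Box

variable {M : Type*} [CommMonoid M] (S : Finset M)

lemma card_boxProducts_le (n : ℕ) : (boxProducts S n).card ≤ (n + 1) ^ S.card := by
  classical
  refine Finset.card_image_le.trans ?_
  simp [Fintype.card_piFinset]

lemma one_mem_boxProducts (n : ℕ) : 1 ∈ boxProducts S n := by
  classical
  exact Finset.mem_image.2 ⟨0, by simp, by simp⟩

lemma boxProducts_mono (n : ℕ) : boxProducts S n ⊆ boxProducts S (n + 1) := by
  classical
  refine Finset.image_subset_image (Fintype.piFinset_subset _ _ fun _ ↦ ?_)
  exact Finset.range_subset_range.2 (by omega)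

lemma mul_mem_boxProducts {n : ℕ} {a s : M} (ha : a ∈ boxProducts S n) (hs : s ∈ S) :
    a * s ∈ boxProducts S (n + 1) := by
  classical
  obtain ⟨e, he, rfl⟩ := Finset.mem_image.1 ha
  refine Finset.mem_image.2 ⟨e + Pi.single ⟨s, hs⟩ 1, ?_, ?_⟩
  · simp only [Fintype.mem_piFinset, Finset.mem_range, Pi.add_apply] at he ⊢
    intro t
    have := he t
    have : (Pi.single (⟨s, hs⟩ : S) 1 : S → ℕ) t ≤ 1 := by
      by_cases h : t = ⟨s, hs⟩ <;> simp [h]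
    omega
  · simp only [Pi.add_apply, pow_add, Finset.prod_mul_distrib]
    congr 1
    rw [Finset.prod_eq_single ⟨s, hs⟩] <;> simp +contextual

lemma boxProducts_subset {T : Submonoid M} (hT : ∀ s ∈ S, s ∈ T) (n : ℕ) :
    ∀ a ∈ boxProducts S n, a ∈ T := by
  classical
  intro a ha
  obtain ⟨e, _, rfl⟩ := Finset.mem_image.1 ha
  exact T.prod_mem fun s _ ↦ T.pow_mem (hT s s.2) _

/-- Otherwise the boxes would grow at least like $(1+\varepsilon)^n$, against the polynomial bound
$(n+1)^{|S|}$. -/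
lemma exists_card_boxProducts_succ_le {ε : ℝ} (hε : 0 < ε) :
    ∃ n, ((boxProducts S (n + 1)).card : ℝ) ≤ (1 + ε) * (boxProducts S n).card := by
  by_contra! hcon
  have hr : 1 < 1 + ε := by linarith
  have hlow : ∀ n, (1 + ε) ^ n ≤ ((boxProducts S n).card : ℝ) := by
    intro n
    induction n with
    | zero =>
      simpa using Finset.card_pos.2 ⟨1, one_mem_boxProducts S 0⟩
    | succ n ih =>
      calc (1 + ε) ^ (n + 1) = (1 + ε) * (1 + ε) ^ n := by ring
        _ ≤ (1 + ε) * (boxProducts S n).card := by gcongr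
        _ ≤ _ := (hcon n).le
  have ht := (Filter.tendsto_add_atTop_iff_nat 1).2
    (tendsto_pow_const_div_const_pow_of_one_lt S.card hr)
  have hlim : ∀ n : ℕ, (1 + ε)⁻¹ ≤ ((n + 1 : ℕ) : ℝ) ^ S.card / (1 + ε) ^ (n + 1) := by
    intro n
    have h1 : ((boxProducts S n).card : ℝ) ≤ ((n + 1 : ℕ) : ℝ) ^ S.card := by
      exact_mod_cast card_boxProducts_le S n
    rw [le_div_iff₀ (by positivity), pow_succ]
    calc (1 + ε)⁻¹ * ((1 + ε) ^ n * (1 + ε)) = (1 + ε) ^ n := by field_simp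
      _ ≤ _ := (hlow n).trans h1
  have := ge_of_tendsto' ht hlim
  have h0 : 0 < (1 + ε)⁻¹ := by positivity
  linarith

end Box

/-! ### Power graphs -/

section Power

variable {V : Type*}

/-- Distinct vertices are adjacent if their distance in `G` is at most `k`. -/
def powerGraph (G : SimpleGraph V) (k : ℕ) : SimpleGraph V where
  Adj x y := x ≠ y ∧ G.dist x y ≤ k
  symm := ⟨fun x y h ↦ ⟨h.1.symm, by rw [G.dist_comm]; exact h.2⟩⟩
  loopless := ⟨fun _ h ↦ h.1 rfl⟩

variable {G : SimpleGraph V}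

lemma IsLocallyFinite.finite_closedBall (hfin : IsLocallyFinite G) (hconn : G.Connected) (x : V)
    (n : ℕ) : {y | G.dist x y ≤ n}.Finite := by
  induction n with
  | zero =>
    refine (Set.finite_singleton x).subset fun y hy ↦ ?_
    exact ((hconn.dist_eq_zero_iff).1 (Nat.le_zero.1 hy)).symm
  | succ n ih =>
    refine (ih.union (ih.biUnion fun z _ ↦ hfin z)).subset fun y hy ↦ ?_
    by_cases h : G.dist x y ≤ n
    · exact Or.inl h
    · right
      obtain ⟨p, hp⟩ := hconn.exists_walk_length_eq_dist y x
      rw [G.dist_comm] at hp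
      cases p with
      | nil => simp at h
      | cons hadj q =>
        rename_i z
        simp only [SimpleGraph.Walk.length_cons] at hp
        have hq := SimpleGraph.dist_le q
        rw [G.dist_comm] at hq
        have hy' : G.dist x y ≤ n + 1 := hy
        exact Set.mem_biUnion (x := z) (show G.dist x z ≤ n by omega) hadj.symm

lemma Iso.dist_le {W : Type*} {G' : SimpleGraph W} (hconn : G.Connected) (γ : G ≃g G') (x y : V) :
    G'.dist (γ x) (γ y) ≤ G.dist x y := by
  obtain ⟨p, hp⟩ := hconn.exists_walk_length_eq_dist x y
  rw [← hp, ← SimpleGraph.Walk.length_map γ.toHom p]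
  exact SimpleGraph.dist_le _

lemma Iso.dist_eq (hconn : G.Connected) (γ : G ≃g G) (x y : V) :
    G.dist (γ x) (γ y) = G.dist x y := by
  refine le_antisymm (Iso.dist_le hconn γ x y) ?_
  simpa using Iso.dist_le hconn γ.symm (γ x) (γ y)

lemma le_powerGraph {k : ℕ} (hk : 1 ≤ k) : G ≤ powerGraph G k := fun _ _ h ↦
  ⟨h.ne, (SimpleGraph.dist_eq_one_iff_adj.2 h).trans_le hk⟩

lemma isLocallyFinite_powerGraph (hfin : IsLocallyFinite G) (hconn : G.Connected) (k : ℕ) :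
    IsLocallyFinite (powerGraph G k) := fun v ↦
  (hfin.finite_closedBall hconn v k).subset fun _ h ↦ h.2

lemma dist_le_length_powerGraph (hconn : G.Connected) {k : ℕ} {x y : V}
    (p : (powerGraph G k).Walk x y) : G.dist x y ≤ k * p.length := by
  induction p with
  | nil => simp
  | cons h p ih =>
    rename_i u v w
    have h1 := hconn.dist_triangle (u := u) (v := v) (w := w)
    have h2 := h.2
    rw [SimpleGraph.Walk.length_cons, mul_add]
    omega

lemma isQuasiIsometric_powerGraph (hconn : G.Connected) {k : ℕ} (hk : 1 ≤ k) :
    IsQuasiIsometric (powerGraph G k) G := by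
  have hk' : (1 : ℝ) ≤ k := by exact_mod_cast hk
  refine ⟨id, k, 0, hk', le_rfl, fun x y ↦ ⟨?_, ?_⟩, fun z ↦ ⟨z, by simp⟩⟩
  · have h1 : (powerGraph G k).dist x y ≤ G.dist x y :=
      (hconn x y).dist_anti (le_powerGraph hk)
    have h2 : ((powerGraph G k).dist x y : ℝ) ≤ G.dist x y := by exact_mod_cast h1
    have h3 : (k : ℝ)⁻¹ ≤ 1 := inv_le_one_of_one_le₀ hk'
    rw [sub_zero]
    exact (mul_le_of_le_one_left (Nat.cast_nonneg _) h3).trans h2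
  · obtain ⟨p, hp⟩ := (hconn.mono (le_powerGraph hk)).exists_walk_length_eq_dist x y
    have := dist_le_length_powerGraph hconn p
    rw [hp] at this
    rw [add_zero]
    exact_mod_cast this

/-- Automorphisms of `G` are automorphisms of its power graphs. -/
def powerIso (hconn : G.Connected) (k : ℕ) (γ : G ≃g G) : powerGraph G k ≃g powerGraph G k where
  toEquiv := γ.toEquiv
  map_rel_iff' := by
    intro a b
    exact and_congr γ.injective.ne_iff (by rw [← Iso.dist_eq hconn γ a b]; rfl)

/-- The automorphisms of a power graph that come from `Γ`. -/
def powerSubgroup (hconn : G.Connected) (k : ℕ) (Γ : Subgroup (G ≃g G)) :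
    Subgroup (powerGraph G k ≃g powerGraph G k) :=
  Γ.map (MonoidHom.mk' (powerIso hconn k) fun _ _ ↦ rfl)

lemma mem_powerSubgroup {hconn : G.Connected} {k : ℕ} {Γ : Subgroup (G ≃g G)}
    {γ' : powerGraph G k ≃g powerGraph G k} :
    γ' ∈ powerSubgroup hconn k Γ ↔ ∃ γ ∈ Γ, γ.toEquiv = γ'.toEquiv := by
  refine Subgroup.mem_map.trans (exists_congr fun γ ↦ and_congr_right fun _ ↦ ⟨?_, fun h ↦ ?_⟩)
  · rintro rfl
    rfl
  · exact RelIso.toEquiv_injective h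

lemma samePermutations_powerSubgroup (hconn : G.Connected) (k : ℕ) (Γ : Subgroup (G ≃g G)) :
    SamePermutations Γ (powerSubgroup hconn k Γ) := by
  ext σ
  constructor
  · rintro ⟨γ, hγ, rfl⟩
    exact ⟨powerIso hconn k γ, mem_powerSubgroup.2 ⟨γ, hγ, rfl⟩, rfl⟩
  · rintro ⟨γ', hγ', rfl⟩
    exact mem_powerSubgroup.1 hγ'

lemma isClosedSubgroup_powerSubgroup (hconn : G.Connected) (k : ℕ) {Γ : Subgroup (G ≃g G)}
    (hΓ : IsClosedSubgroup Γ) : IsClosedSubgroup (powerSubgroup hconn k Γ) := by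
  let _ : TopologicalSpace V := ⊥
  have : DiscreteTopology V := ⟨rfl⟩
  obtain ⟨T, hT, hTΓ⟩ := isClosed_induced_iff.1 hΓ
  refine isClosed_induced_iff.2
    -- An automorphism of the power graph need not preserve $G$-adjacency, so this is imposed
    -- separately; each condition involves only two coordinates, hence is closed.
    ⟨T ∩ ⋂ x : V, ⋂ y : V, {f : V → V | G.Adj (f x) (f y) ↔ G.Adj x y}, ?_, ?_⟩
  · refine hT.inter (isClosed_iInter fun x ↦ isClosed_iInter fun y ↦ ?_)
    have hc : Continuous fun f : V → V ↦ (f x, f y) :=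
      (continuous_apply x).prodMk (continuous_apply y)
    exact (isClosed_discrete {p : V × V | G.Adj p.1 p.2 ↔ G.Adj x y}).preimage hc
  · ext γ'
    simp only [Set.mem_preimage, Set.mem_inter_iff, Set.mem_iInter, Set.mem_ofPred_eq,
      SetLike.mem_coe]
    rw [mem_powerSubgroup]
    constructor
    · rintro ⟨h1, h2⟩
      refine ⟨⟨γ'.toEquiv, h2 _ _⟩, ?_, rfl⟩
      rw [← SetLike.mem_coe, ← hTΓ]
      exact h1
    · rintro ⟨γ, hγ, h⟩
      have h' : ∀ v, γ' v = γ v := fun v ↦ (DFunLike.congr_fun h v).symm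
      simp only [h']
      refine ⟨?_, fun x y ↦ γ.map_adj_iff⟩
      rw [← SetLike.mem_coe, ← hTΓ] at hγ
      exact hγ

/-- Suborbits, and hence weights, depend only on the underlying set of permutations. -/
lemma orbit_stabilizer_eq_image (Γ : Subgroup (G ≃g G)) (x y : V) :
    orbit (stabilizer Γ x) y =
      (fun σ : Equiv.Perm V ↦ σ y) '' {σ | (∃ γ ∈ Γ, γ.toEquiv = σ) ∧ σ x = x} := by
  ext z
  constructor
  · rintro ⟨⟨⟨γ, hγ⟩, hx⟩, rfl⟩
    exact ⟨γ.toEquiv, ⟨⟨γ, hγ, rfl⟩, hx⟩, rfl⟩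
  · rintro ⟨_, ⟨⟨γ, hγ, rfl⟩, hx⟩, rfl⟩
    exact ⟨⟨⟨γ, hγ⟩, hx⟩, rfl⟩

lemma SamePermutations.relWeight_eq {G' : SimpleGraph V} {Γ : Subgroup (G ≃g G)}
    {Γ' : Subgroup (G' ≃g G')} (h : SamePermutations Γ Γ') : relWeight Γ' = relWeight Γ := by
  have key : ∀ σ : Equiv.Perm V, (∃ γ ∈ Γ', γ.toEquiv = σ) ↔ ∃ γ ∈ Γ, γ.toEquiv = σ :=
    fun σ ↦ (Set.ext_iff.1 h σ).symm
  funext o x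
  simp only [relWeight, orbit_stabilizer_eq_image, key]

lemma isTransitiveGraph_powerGraph (hconn : G.Connected) (k : ℕ) (Γ : Subgroup (G ≃g G))
    [IsPretransitive Γ V] : IsTransitiveGraph (powerGraph G k) :=
  ⟨fun x y ↦ by
    obtain ⟨γ, h⟩ := exists_smul_eq Γ x y
    exact ⟨powerIso hconn k γ, h⟩⟩

lemma finiteSuborbits (hconn : G.Connected) (hfin : IsLocallyFinite G) (Γ : Subgroup (G ≃g G)) :
    FiniteSuborbits Γ V := by
  intro x y
  refine (hfin.finite_closedBall hconn x (G.dist x y)).subset ?_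
  rintro _ ⟨⟨γ, hγ⟩, rfl⟩
  have hx : γ.1 x = x := hγ
  have := Iso.dist_eq hconn γ.1 x y
  rw [hx] at this
  exact this.le

lemma Orbital.dist_eq (hconn : G.Connected) {Γ : Subgroup (G ≃g G)} {o z x y : V}
    (h : Orbital Γ o z x y) : G.dist x y = G.dist o z := by
  obtain ⟨γ, rfl, rfl⟩ := h
  exact Iso.dist_eq hconn γ.1 o z

lemma IsLocallyFinite.finite_vertexBoundary (hfin : IsLocallyFinite G) {F : Set V}
    (hF : F.Finite) : (vertexBoundary G F).Finite :=
  (hF.biUnion fun z _ ↦ hfin z).subset fun _ hy ↦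
    Set.mem_biUnion hy.2.choose_spec.1 hy.2.choose_spec.2

end Power

/-! ### Transferring boundaries between levels and the whole graph -/

variable {V : Type*} {G : SimpleGraph V}

lemma setWeight_eq_sum {Γ : Subgroup (G ≃g G)} {o : V} (F : Finset V) :
    setWeight Γ o F = ∑ x ∈ F, actWeight Γ o x :=
  finsum_mem_coe_finset _ F

lemma sum_actWeight_fiber {Γ : Subgroup (G ≃g G)} {o : V} (F : Finset V) {B : Finset ℝ}
    (hB : ∀ y ∈ F, actWeight Γ o y ∈ B) :
    setWeight Γ o F =
      ∑ b ∈ B, ((open Classical in F.filter fun y ↦ actWeight Γ o y = b).card : ℝ) * b := by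
  classical
  rw [setWeight_eq_sum, ← Finset.sum_fiberwise_of_maps_to hB]
  refine Finset.sum_congr rfl fun b _ ↦ ?_
  rw [Finset.sum_congr rfl fun y hy ↦ (Finset.mem_filter.1 hy).2, Finset.sum_const, nsmul_eq_mul]

lemma FiniteSuborbits.setWeight_mul {Γ : Subgroup (G ≃g G)} (h : FiniteSuborbits Γ V) (o x : V)
    (F : Finset V) : setWeight Γ o F = actWeight Γ o x * setWeight Γ x F := by
  rw [setWeight_eq_sum, setWeight_eq_sum, Finset.mul_sum]
  exact Finset.sum_congr rfl fun y _ ↦ (h.actWeight_mul o x y).symm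

/-- The weights of the action form a submonoid of the reals. -/
def weightSubmonoid {Γ : Subgroup (G ≃g G)} (h : FiniteSuborbits Γ V) [IsPretransitive Γ V]
    (o : V) : Submonoid ℝ where
  carrier := Set.range (actWeight Γ o)
  one_mem' := ⟨o, h.actWeight_self o⟩
  mul_mem' := by
    rintro _ _ ⟨x, rfl⟩ ⟨y, rfl⟩
    obtain ⟨γ, rfl⟩ := exists_smul_eq Γ o x
    -- Since $\gamma o = x$, the vertex $\gamma y$ has the same weight relative to $x$ as $y$ has
    -- relative to $o$.
    refine ⟨γ • y, ?_⟩
    rw [← h.actWeight_mul o (γ • o) (γ • y), actWeight_smul]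

/-- Finite sets of weights with small boundary under multiplication by the weights of
neighbours. -/
lemma exists_folner_weights {Γ : Subgroup (G ≃g G)} (h : FiniteSuborbits Γ V)
    [IsPretransitive Γ V] (hfin : IsLocallyFinite G) (o : V) {ε : ℝ} (hε : 0 < ε) :
    ∃ B B' : Finset ℝ, B.Nonempty ∧ B ⊆ B' ∧ (B'.card : ℝ) ≤ (1 + ε) * B.card ∧
      (∀ b ∈ B', ∃ z, actWeight Γ o z = b) ∧
      ∀ x y, G.Adj x y → ∀ b ∈ B, b * actWeight Γ x y ∈ B' := by
  classical
  let S : Finset ℝ := (hfin o).toFinset.image (actWeight Γ o)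
  obtain ⟨n, hn⟩ := exists_card_boxProducts_succ_le S hε
  refine ⟨boxProducts S n, boxProducts S (n + 1), ⟨1, one_mem_boxProducts S n⟩,
    boxProducts_mono S n, hn, ?_, fun x y hxy b hb ↦ mul_mem_boxProducts S hb ?_⟩
  · refine boxProducts_subset S (T := weightSubmonoid h o) (fun s hs ↦ ?_) (n + 1)
    obtain ⟨y, _, rfl⟩ := Finset.mem_image.1 hs
    exact ⟨y, rfl⟩
  · obtain ⟨γ, rfl⟩ := exists_smul_eq Γ x o
    refine Finset.mem_image.2 ⟨γ • y, ?_, actWeight_smul γ x y⟩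
    rw [Set.Finite.mem_toFinset]
    exact γ.1.map_adj_iff.2 hxy

/-- The union over `b ∈ B` of the translates of `K` along the orbital relation of
`(o, z b)`. -/
def orbitalSaturation (Γ : Subgroup (G ≃g G)) (o : V) (z : ℝ → V) (B : Finset ℝ) (K : Set V) :
    Set V :=
  {y | ∃ b ∈ B, ∃ x ∈ K, Orbital Γ o (z b) x y}

lemma finite_orbitalSaturation {Γ : Subgroup (G ≃g G)} (h : FiniteSuborbits Γ V)
    [IsPretransitive Γ V] (o : V) (z : ℝ → V) (B : Finset ℝ) {K : Set V} (hK : K.Finite) :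
    (orbitalSaturation Γ o z B K).Finite := by
  refine (B.finite_toSet.biUnion fun b _ ↦ hK.biUnion fun x _ ↦
    h.finite_orbital o (z b) x).subset ?_
  rintro y ⟨b, hb, x, hx, hy⟩
  exact Set.mem_biUnion hb (Set.mem_biUnion hx hy)

/-- A finite subset of a level with small boundary gives rise to a finite set of vertices of small
weighted boundary. -/
lemma exists_setWeight_vertexBoundary_le {Γ : Subgroup (G ≃g G)} (hconn : G.Connected)
    (hfin : IsLocallyFinite G) [IsPretransitive Γ V] {o x : V} {z : ℝ → V} {B B' : Finset ℝ}
    {ε : ℝ} (hε : 0 ≤ ε) (hB : B.Nonempty) (hBB' : B ⊆ B')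
    (hcard : (B'.card : ℝ) ≤ (1 + ε) * B.card) (hz : ∀ b ∈ B', actWeight Γ o (z b) = b)
    (hadj : ∀ x y, G.Adj x y → ∀ b ∈ B, b * actWeight Γ x y ∈ B') {r : ℕ}
    (hr : ∀ b ∈ B', G.dist o (z b) ≤ r) {K D : Finset V} (hK : K.Nonempty)
    (hKx : ∀ y ∈ K, actWeight Γ x y = 1)
    (hD : ∀ y, actWeight Γ x y = 1 → y ∉ K → (∃ u ∈ K, G.dist u y ≤ 2 * r + 1) → y ∈ D)
    (hDK : (D.card : ℝ) ≤ ε * K.card) :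
    ∃ F : Finset V, F.Nonempty ∧
      setWeight Γ x (vertexBoundary G F) ≤ ε * (2 + ε) * setWeight Γ x F := by
  classical
  have h := finiteSuborbits hconn hfin Γ
  have hw : ∀ b ∈ B', ∀ u y, Orbital Γ o (z b) u y → actWeight Γ u y = b :=
    fun b hb u y hu ↦ hu.actWeight.trans (hz b hb)
  have hpos : ∀ b ∈ B', 0 < b := fun b hb ↦ hz b hb ▸ h.actWeight_pos _ _
  have hFfin := finite_orbitalSaturation h o z B K.finite_toSet
  set F := hFfin.toFinset with hF
  have hmem : ∀ y, y ∈ F ↔ ∃ b ∈ B, ∃ u ∈ K, Orbital Γ o (z b) u y := fun y ↦ by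
    rw [hF, Set.Finite.mem_toFinset]; rfl
  have hwF : ∀ b ∈ B', ∀ u ∈ K, ∀ y, Orbital Γ o (z b) u y → actWeight Γ x y = b := by
    intro b hb u hu y huy
    rw [← h.actWeight_mul x u y, hKx u hu, hw b hb u y huy, one_mul]
  -- the weight of `F`
  have hFB : ∀ y ∈ F, actWeight Γ x y ∈ B := by
    intro y hy
    obtain ⟨b, hb, u, hu, huy⟩ := (hmem y).1 hy
    rwa [hwF b (hBB' hb) u hu y huy]
  -- Each fibre of $F$ over a weight $b \in B$ carries weight at least $|K|$.
  have hlow : (B.card : ℝ) * K.card ≤ setWeight Γ x F := by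
    rw [sum_actWeight_fiber F hFB, ← nsmul_eq_mul]
    refine Finset.card_nsmul_le_sum _ _ _ fun b hb ↦ ?_
    have := h.card_le_card_mul_actWeight o (z b) (X := K)
      (Y := F.filter fun y ↦ actWeight Γ x y = b) (fun u hu y huy ↦
        Finset.mem_filter.2 ⟨(hmem y).2 ⟨b, hb, u, hu, huy⟩, hwF b (hBB' hb) u hu y huy⟩)
    rwa [hz b (hBB' hb)] at this
  -- the weight of the boundary
  have hbfin := hfin.finite_vertexBoundary F.finite_toSet
  set E := hbfin.toFinset with hE
  have hEmem : ∀ y, y ∈ E ↔ y ∉ F ∧ ∃ u ∈ F, G.Adj u y := fun y ↦ by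
    rw [hE, Set.Finite.mem_toFinset]; rfl
  have hEB : ∀ y ∈ E, actWeight Γ x y ∈ B' := by
    intro y hy
    obtain ⟨_, u, hu, huy⟩ := (hEmem y).1 hy
    rw [← h.actWeight_mul x u y]
    exact hadj u y huy _ (hFB u hu)
  -- A source $u$ of $y$ has weight $b/b = 1$, so it lies in the level of $x$. The path $t, v, y, u$
  -- has steps of length at most $r$, $1$, $r$, whence the radius $2r+1$.
  have hsrc : ∀ b ∈ B', ∀ y ∈ E, actWeight Γ x y = b → ∀ u, Orbital Γ o (z b) u y →
      u ∉ K → u ∈ D := by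
    intro b hb y hy hyb u huy huK
    obtain ⟨_, v, hv, hvy⟩ := (hEmem y).1 hy
    obtain ⟨c, hc, t, ht, htv⟩ := (hmem v).1 hv
    refine hD u ?_ huK ⟨t, ht, ?_⟩
    · have := h.actWeight_mul x u y
      rw [hw b hb u y huy, hyb] at this
      exact mul_right_cancel₀ (hpos b hb).ne' (by rw [this, one_mul])
    · have h1 := hconn.dist_triangle (u := t) (v := v) (w := u)
      have h2 := hconn.dist_triangle (u := v) (v := y) (w := u)
      have h3 := htv.dist_eq hconn
      have h4 := huy.dist_eq hconn
      have h5 := hr b hb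
      have h6 := hr c (hBB' hc)
      have h7 := SimpleGraph.dist_eq_one_iff_adj.2 hvy
      rw [G.dist_comm (u := y)] at h2
      omega
  have hup1 : ∀ b ∈ B', ((E.filter fun y ↦ actWeight Γ x y = b).card : ℝ) * b ≤
      (1 + ε) * K.card := by
    intro b hb
    have := h.card_mul_actWeight_le_card o (z b) (X := K ∪ D)
      (Y := E.filter fun y ↦ actWeight Γ x y = b) (fun y hy u huy ↦ by
        obtain ⟨hy, hyb⟩ := Finset.mem_filter.1 hy
        by_cases hu : u ∈ K
        · exact Finset.mem_union_left _ hu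
        · exact Finset.mem_union_right _ (hsrc b hb y hy hyb u huy hu))
    rw [hz b hb] at this
    have h2 : ((K ∪ D).card : ℝ) ≤ K.card + D.card := by
      exact_mod_cast Finset.card_union_le K D
    linarith
  -- For $b \in B$ a source in $K$ would put $y$ into $F$, so all sources lie in $D$.
  have hup2 : ∀ b ∈ B, ((E.filter fun y ↦ actWeight Γ x y = b).card : ℝ) * b ≤
      ε * K.card := by
    intro b hb
    have := h.card_mul_actWeight_le_card o (z b) (X := D)
      (Y := E.filter fun y ↦ actWeight Γ x y = b) (fun y hy u huy ↦ by
        obtain ⟨hy, hyb⟩ := Finset.mem_filter.1 hy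
        refine hsrc b (hBB' hb) y hy hyb u huy fun hu ↦ ?_
        exact ((hEmem y).1 hy).1 ((hmem y).2 ⟨b, hb, u, hu, huy⟩))
    rw [hz b (hBB' hb)] at this
    exact this.trans hDK
  have hcard' : ((B' \ B).card : ℝ) ≤ ε * B.card := by
    have := Finset.card_sdiff_add_card_eq_card hBB'
    have : ((B' \ B).card : ℝ) + B.card = B'.card := by exact_mod_cast this
    linarith
  -- Weights in $B' \setminus B$ contribute $\varepsilon(1+\varepsilon)$ and weights in $B$
  -- contribute $\varepsilon$, in units of $|B||K|$.
  have hupper : setWeight Γ x (vertexBoundary G F) ≤ ε * (2 + ε) * (B.card * K.card) := by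
    rw [← hbfin.coe_toFinset, ← hE, sum_actWeight_fiber E hEB, ← Finset.sum_sdiff hBB']
    have h1 := Finset.sum_le_card_nsmul (B' \ B) _ _ fun b hb ↦
      hup1 b (Finset.sdiff_subset hb)
    have h2 := Finset.sum_le_card_nsmul B _ _ hup2
    rw [nsmul_eq_mul] at h1 h2
    have h3 := mul_le_mul_of_nonneg_right hcard'
      (show 0 ≤ (1 + ε) * (K.card : ℝ) by positivity)
    linarith
  obtain ⟨b, hb⟩ := hB
  obtain ⟨u, hu⟩ := hK
  obtain ⟨y, hy⟩ : {y | Orbital Γ o (z b) u y}.Nonempty := by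
    obtain ⟨γ, hγ⟩ := exists_smul_eq Γ o u
    exact ⟨γ • z b, γ, hγ, rfl⟩
  exact ⟨F, ⟨y, (hmem y).2 ⟨b, hb, u, hu, hy⟩⟩,
    hupper.trans (mul_le_mul_of_nonneg_left hlow (by positivity))⟩

lemma exists_finset_card_boundary_lt {L : Set V} [hL : Nonempty L] {G' : SimpleGraph V}
    (hfin : IsLocallyFinite G') (ha : IsAmenable (G'.induce L)) {ε : ℝ} (hε : 0 < ε) :
    ∃ K D : Finset V, K.Nonempty ∧ (∀ y ∈ K, y ∈ L) ∧
      (∀ y ∈ L, y ∉ K → (∃ u ∈ K, G'.Adj u y) → y ∈ D) ∧ (D.card : ℝ) ≤ ε * K.card := by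
  classical
  rw [IsAmenable, cheegerConst] at ha
  obtain ⟨_, ⟨F, hF, hne, rfl⟩, hlt⟩ := exists_lt_of_csInf_lt
    -- The level must be nonempty: over an empty one the infimum would be $0$ by default.
    (by
      obtain ⟨x⟩ := hL
      exact ⟨_, {x}, Set.finite_singleton x, Set.singleton_nonempty x, rfl⟩)
    (ha.trans_lt hε)
  have hfin' : IsLocallyFinite (G'.induce L) := fun v ↦
    Set.Finite.of_finite_image ((hfin v).subset (by rintro _ ⟨y, hy, rfl⟩; exact hy))
      Subtype.val_injective.injOn
  have hDfin := hfin'.finite_vertexBoundary hF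
  refine ⟨hF.toFinset.map (.subtype _), hDfin.toFinset.map (.subtype _), by simpa using hne,
    fun y hy ↦ ?_, fun y hy hyK hu ↦ ?_, ?_⟩
  · obtain ⟨a, _, rfl⟩ := Finset.mem_map.1 hy
    exact a.2
  · refine Finset.mem_map.2 ⟨⟨y, hy⟩, hDfin.mem_toFinset.2 ⟨fun h ↦ hyK ?_, ?_⟩, rfl⟩
    · exact Finset.mem_map.2 ⟨⟨y, hy⟩, hF.mem_toFinset.2 h, rfl⟩
    · obtain ⟨u, hu, huy⟩ := hu
      obtain ⟨a, ha, rfl⟩ := Finset.mem_map.1 hu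
      exact ⟨a, hF.mem_toFinset.1 ha, huy⟩
  · rw [Finset.card_map, Finset.card_map, ← Set.ncard_eq_toFinset_card _ hDfin,
      ← Set.ncard_eq_toFinset_card _ hF]
    exact ((div_lt_iff₀ (Nat.cast_pos.2 ((Set.ncard_pos hF).2 hne))).1 hlt).le

lemma setWeight_nonneg (Γ : Subgroup (G ≃g G)) (o : V) (A : Set V) : 0 ≤ setWeight Γ o A :=
  finsum_nonneg fun _ ↦ finsum_nonneg fun _ ↦ div_nonneg (Nat.cast_nonneg _) (Nat.cast_nonneg _)

lemma exists_pos_mul_setWeight_le {Γ : Subgroup (G ≃g G)} (h : FiniteSuborbits Γ V)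
    (hfin : IsLocallyFinite G) {o : V} (ho : ¬ IsWeightedAmenable Γ o) :
    ∃ c : ℝ, 0 < c ∧ ∀ x (F : Finset V), F.Nonempty →
      c * setWeight Γ x F ≤ setWeight Γ x (vertexBoundary G F) := by
  set R := {r : ℝ | ∃ F : Set V, F.Finite ∧ F.Nonempty ∧
    r = setWeight Γ o (vertexBoundary G F) / setWeight Γ o F} with hR
  have hnn : ∀ r ∈ R, 0 ≤ r := by
    rintro _ ⟨F, _, _, rfl⟩
    exact div_nonneg (setWeight_nonneg _ _ _) (setWeight_nonneg _ _ _)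
  refine ⟨sInf R, lt_of_le_of_ne (Real.sInf_nonneg hnn) (Ne.symm ho), fun x F hF ↦ ?_⟩
  have hpos : 0 < setWeight Γ o F := by
    rw [setWeight_eq_sum]
    exact Finset.sum_pos (fun y _ ↦ h.actWeight_pos o y) hF
  have hle : sInf R ≤ _ := csInf_le ⟨0, hnn⟩ ⟨F, F.finite_toSet, hF, rfl⟩
  -- Changing the reference vertex from $o$ to $x$ rescales both sides by the same positive factor,
  -- so one constant serves all $x$.
  rw [le_div_iff₀ hpos, h.setWeight_mul o x F,
    ← (hfin.finite_vertexBoundary F.finite_toSet).coe_toFinset, h.setWeight_mul o x,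
    Set.Finite.coe_toFinset, mul_left_comm] at hle
  exact le_of_mul_le_mul_left hle (h.actWeight_pos o x)

/-- If `G` is weighted-nonamenable, then the levels are nonamenable in a suitable power of `G`. -/
lemma exists_powerGraph_level_nonamenable (hconn : G.Connected) (hfin : IsLocallyFinite G)
    (Γ : Subgroup (G ≃g G)) [IsPretransitive Γ V] (o : V) (ho : ¬ IsWeightedAmenable Γ o) :
    ∃ k, 1 ≤ k ∧ ∀ x, ¬ IsAmenable ((powerGraph G k).induce (level Γ x)) := by
  classical
  have h := finiteSuborbits hconn hfin Γ
  obtain ⟨c, hc, hcF⟩ := exists_pos_mul_setWeight_le h hfin ho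
  obtain ⟨ε, hε, hεc⟩ : ∃ ε : ℝ, 0 < ε ∧ ε * (2 + ε) < c := by
    -- With this choice $\varepsilon(2+\varepsilon) \le 3\varepsilon \le 3c/4 < c$.
    refine ⟨min 1 (c / 4), by positivity, ?_⟩
    have h1 := min_le_left 1 (c / 4)
    have h2 := min_le_right 1 (c / 4)
    have h3 : 0 < min 1 (c / 4) := by positivity
    nlinarith
  obtain ⟨B, B', hB, hBB', hcard, hz, hadj⟩ := exists_folner_weights h hfin o hε
  have : Nonempty V := ⟨o⟩
  choose! z hz using hz
  -- The radius depends only on $B'$ and the $z_b$, not on the level or on $K$, so one power works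
  -- for every level.
  set r := B'.sup fun b ↦ G.dist o (z b)
  have hr : ∀ b ∈ B', G.dist o (z b) ≤ r := fun b hb ↦
    Finset.le_sup (f := fun b ↦ G.dist o (z b)) hb
  refine ⟨2 * r + 1, by omega, fun x hx ↦ ?_⟩
  have : Nonempty (level Γ x) := ⟨⟨x, h.actWeight_self x⟩⟩
  obtain ⟨K, D, hK, hKx, hD, hDK⟩ :=
    exists_finset_card_boundary_lt (isLocallyFinite_powerGraph hfin hconn _) hx hε
  obtain ⟨F, hF, hlt⟩ := exists_setWeight_vertexBoundary_le hconn hfin hε.le hB hBB' hcard hz hadj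
    hr hK hKx (fun y hy hyK ⟨u, hu, huy⟩ ↦
      hD y hy hyK ⟨u, hu, fun e ↦ hyK (e ▸ hu), huy⟩) hDK
  have hpos : 0 < setWeight Γ x F := by
    rw [setWeight_eq_sum]
    exact Finset.sum_pos (fun y _ ↦ h.actWeight_pos x y) hF
  have := (hcF x F hF).trans hlt
  exact absurd (le_of_mul_le_mul_right this hpos) (not_le.2 hεc)

end WeightedGraph

theorem mainTheorem10 {V : Type*} (G : SimpleGraph V)
    (hconn : G.Connected) (hfin : WeightedGraph.IsLocallyFinite G)
    (Γ : Subgroup (G ≃g G)) (hclosed : WeightedGraph.IsClosedSubgroup Γ)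
    (htrans : MulAction.IsPretransitive Γ V)
    (o : V) (hnonam : ¬ WeightedGraph.IsWeightedAmenable Γ o) :
    ∃ G' : SimpleGraph V,
      G'.Connected ∧ WeightedGraph.IsLocallyFinite G' ∧ WeightedGraph.IsTransitiveGraph G' ∧
      WeightedGraph.IsQuasiIsometric G' G ∧
      ∃ Γ' : Subgroup (G' ≃g G'),
        WeightedGraph.SamePermutations Γ Γ' ∧
        WeightedGraph.IsClosedSubgroup Γ' ∧
        WeightedGraph.relWeight Γ' = WeightedGraph.relWeight Γ ∧
        ∀ x : V, ¬ WeightedGraph.IsAmenable (G'.induce (WeightedGraph.level Γ' x)) := by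
  obtain ⟨k, hk, hlevel⟩ :=
    WeightedGraph.exists_powerGraph_level_nonamenable hconn hfin Γ o hnonam
  have hsame := WeightedGraph.samePermutations_powerSubgroup hconn k Γ
  have hweight := hsame.relWeight_eq
  refine ⟨WeightedGraph.powerGraph G k, hconn.mono (WeightedGraph.le_powerGraph hk),
    WeightedGraph.isLocallyFinite_powerGraph hfin hconn k,
    WeightedGraph.isTransitiveGraph_powerGraph hconn k Γ,
    WeightedGraph.isQuasiIsometric_powerGraph hconn hk,
    WeightedGraph.powerSubgroup hconn k Γ, hsame,
    WeightedGraph.isClosedSubgroup_powerSubgroup hconn k hclosed, hweight, fun x ↦ ?_⟩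
  have hlev : WeightedGraph.level (WeightedGraph.powerSubgroup hconn k Γ) x =
      WeightedGraph.level Γ x := by
    simp only [WeightedGraph.level, hweight]
  rw [hlev]
  exact hlevel x
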